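/- Let $\theta>0$. For i.i.d. nonnegative interarrival times $X_1,X_2,\dots$ (with an arbitrary law: continuous, discrete and possibly non-integer, or mixed), distributed as $X$ with $\Pr(X=0)<1$, let $N_t=\max\{n:\ X_1+\dots+X_n\le t\}$ be the renewal counting process. The effective capacity of a service process $S_t$ at the QoS exponent $\theta$ is $$C_e=-\lim_{t\to\infty}\frac{1}{\theta t}\ln \mathbb E\left[e^{-\theta S_t}\right],$$ the limit being over real $t$; whenever a value of $C_e$ is asserted below, it is part of the claim that these expectations are finite for $t\ge 0$ and that the limit exists. (i) Constant reward. Let $R\ge 0$ and $S_t=RN_t$. Consider the equation $$\mathbb E\left[\zeta^{X}\right]=e^{\theta R},\qquad \zeta\ge 0. \tag{1}$$ It has a solution if $X$ is almost surely bounded, and more generally whenever $e^{\theta R}\le \mathbb E[z^X]<\infty$ for some $z\ge 1$. If $\zeta$ is a solution of (1), then it is the only one, $\zeta\in\left[1,e^{\theta R/\mathbb E[X]}\right]$ (where $\mathbb E[X]<\infty$ if $R>0$; for $R=0$ the interval is $\{1\}$), and $$C_e=\frac{\ln\zeta}{\theta}.$$ (ii) Variable reward. Let $(X_1,\mathfrak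 S_1),(X_2,\mathfrak S_2),\dots$ be i.i.d. copies of $(X,\mathfrak S)$, with $X$ as above and $\mathfrak S$ taking values in a measurable space, let $\mathcal R$ be a measurable real-valued function of $(x,s)$, and let $S_t=\sum_{i=1}^{N_t}\mathcal R(X_i,\mathfrak S_i)$. Consider the equation $$\mathbb E\left[e^{-\theta \mathcal R(X,\mathfrak S)}\zeta^{X}\right]=1,\qquad \zeta\ge 1. \tag{2}$$ If $\mathcal R(X,\mathfrak S)\ge 0$ almost surely, then (2) has a solution if $X$ is almost surely bounded, and more generally whenever $1\le \mathbb E[e^{-\theta \mathcal R(X,\mathfrak S)}z^X]<\infty$ for some $z\ge 1$. A solution $\zeta$ of (2), if there is one, is unique. If $\zeta$ is the solution of (2) and $\mathbb E[z^X]<\infty$ for all $1\le z<\zeta$ (which is automatic if $X$ is bounded or if $\mathcal R(X,\mathfrak S)$ is bounded above), then $$C_e=\frac{\ln\zeta}{\theta}.$$ -/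

import Mathlib

open MeasureTheory ProbabilityTheory Filter Topology

/-- The random variables `Y 0, Y 1, …` on `(Ω, μ)` are independent and identically distributed. -/
structure IsIIDSequence {Ω E : Type*} [MeasurableSpace Ω] [MeasurableSpace E]
    (Y : ℕ → Ω → E) (μ : Measure Ω) : Prop where
  measurable : ∀ i, Measurable (Y i)
  indep : iIndepFun Y μ
  identDistrib : ∀ i, IdentDistrib (Y i) (Y 0) μ μ

/-- Partial sums of the interarrival times: the time of the `n`-th renewal. The interarrival
times are indexed from `0`, so the first `n` of them are `X 0, …, X (n - 1)`. -/
def renewalTime {Ω : Type*} (X : ℕ → Ω → ℝ) (n : ℕ) (ω : Ω) : ℝ :=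
  ∑ i ∈ Finset.range n, X i ω

/-- The renewal counting process `N_t = max {n : X_1 + ⋯ + X_n ≤ t}`. (For i.i.d. nonnegative
interarrival times that are not almost surely zero the set is almost surely finite, so that for
`t ≥ 0` the supremum is a maximum.) -/
noncomputable def renewalCount {Ω : Type*} (X : ℕ → Ω → ℝ) (t : ℝ) (ω : Ω) : ℕ :=
  sSup {n : ℕ | renewalTime X n ω ≤ t}

/-- The total reward up to time `t` when the `i`-th renewal earns the reward `r i`. -/
noncomputable def accumulatedReward {Ω : Type*} (X r : ℕ → Ω → ℝ) (t : ℝ) (ω : Ω) : ℝ :=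
  ∑ i ∈ Finset.range (renewalCount X t ω), r i ω

/-- The service process `A`, where `A t` is the total service up to time `t`, has effective
capacity `C` at the QoS exponent `θ`: the expectations `E[exp (-θ A_t)]` are finite and
`-(1 / (θ t)) log E[exp (-θ A_t)] → C` as `t → ∞` through the reals. -/
def HasEffectiveCapacity {Ω : Type*} [MeasurableSpace Ω] (μ : Measure Ω) (θ : ℝ)
    (A : ℝ → Ω → ℝ) (C : ℝ) : Prop :=
  (∀ t : ℝ, 0 ≤ t → Integrable (fun ω => Real.exp (-θ * A t ω)) μ) ∧
    Tendsto (fun t : ℝ => -(1 / (θ * t)) * Real.log (∫ ω, Real.exp (-θ * A t ω) ∂μ)) atTop (𝓝 C)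

/-- `ζ ≥ 0` and `E[ζ ^ X] = exp (θ R)`, the expectation being finite. -/
def IsConstRewardRoot {Ω : Type*} [MeasurableSpace Ω] (μ : Measure Ω) (θ R : ℝ)
    (X : Ω → ℝ) (ζ : ℝ) : Prop :=
  0 ≤ ζ ∧ Integrable (fun ω => ζ ^ X ω) μ ∧ ∫ ω, ζ ^ X ω ∂μ = Real.exp (θ * R)

/-- `ζ ≥ 1` and `E[exp (-θ r) * ζ ^ X] = 1`, the expectation being finite. -/
def IsVarRewardRoot {Ω : Type*} [MeasurableSpace Ω] (μ : Measure Ω) (θ : ℝ)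
    (r X : Ω → ℝ) (ζ : ℝ) : Prop :=
  1 ≤ ζ ∧ Integrable (fun ω => Real.exp (-θ * r ω) * ζ ^ X ω) μ ∧
    ∫ ω, Real.exp (-θ * r ω) * ζ ^ X ω ∂μ = 1

/-!
Write `Φ z = E[exp (-θ r) * z ^ X]` for a generic interarrival time `X` with reward `r`. Since
`X ≥ 0` is not almost surely zero, `Φ` is strictly increasing where it is finite
(`tiltedTransform_lt_of_lt`), so a root `ζ` of `Φ ζ = 1` is unique; if `r ≥ 0`, then `Φ 1 ≤ 1` and
the intermediate value theorem gives existence. A constant reward `R ≥ 0` is a special case, because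
a root of `E[ζ ^ X] = exp (θ R)` cannot lie below `1` (`isConstRewardRoot_iff`); the upper bound
for `ζ` is Jensen's inequality.

For the effective capacity, `m t = E[exp (-θ A_t)]` is expanded over the value of `N_t`. Since the
`n`-th renewal time and the first `n` rewards are independent of the next interarrival time and its
reward, this gives both an explicit series and the renewal equation
`m t = P(X > t) + E[exp (-θ r) * m (t - X)]` (`renewalMoment_eq`).

* For `z < ζ` one has `Φ z < 1`, and Markov's inequality bounds the `n`-th term of the series by a
  constant times `z ^ (-t) * Φ z ^ n`. Summing a geometric series gives `m t = O(z ^ (-t))`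
  (`renewalMoment_mul_rpow_le`). This is where `E[z ^ X] < ∞` is needed.
* For `z > ζ` one has `Φ z > 1`, even after truncating to `X ≤ A` for some `A`. The renewal
  equation then shows that `m t * z ^ t` is bounded below on `[0, ∞)` by its infimum over `[0, A]`,
  which is positive (`exists_pos_le_renewalMoment_mul_rpow`). No renewal theorem is involved, and
  lattice and non-lattice laws are treated alike.

Letting `z` tend to `ζ` from both sides, `-(1 / t) * log (m t)` tends to `log ζ`.
-/

open scoped ENNReal

/-! ### The tilted transform and its roots -/

/-- The transform `z ↦ E[exp (-θ r) * z ^ X]`, as an extended nonnegative number, so that no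
integrability is presupposed. -/
noncomputable def tiltedTransform {Ω : Type*} [MeasurableSpace Ω] (μ : Measure Ω) (θ : ℝ)
    (r X : Ω → ℝ) (z : ℝ) : ℝ≥0∞ :=
  ∫⁻ ω, ENNReal.ofReal (Real.exp (-θ * r ω) * z ^ X ω) ∂μ

section Roots

variable {Ω : Type*} [MeasurableSpace Ω] {μ : Measure Ω} {θ : ℝ} {r X : Ω → ℝ}

theorem exists_pos_measure_le_and_le_exp (θ : ℝ) (r : Ω → ℝ) (h0 : ∀ᵐ ω ∂μ, 0 ≤ X ω)
    (hX0 : ¬ ∀ᵐ ω ∂μ, X ω = 0) :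
    ∃ ε : ℝ, 0 < ε ∧ μ {ω | ε ≤ X ω ∧ ε ≤ Real.exp (-θ * r ω)} ≠ 0 := by
  by_contra! hcon
  refine hX0 ?_
  have h1 : ∀ᵐ ω ∂μ, ∀ n : ℕ,
      ¬ ((1 / ((n : ℝ) + 1)) ≤ X ω ∧ (1 / ((n : ℝ) + 1)) ≤ Real.exp (-θ * r ω)) := by
    rw [ae_all_iff]
    intro n
    have := hcon (1 / ((n : ℝ) + 1)) (by positivity)
    rw [ae_iff]
    simpa using this
  filter_upwards [h0, h1] with ω hω hn
  by_contra hne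
  have hpos : 0 < X ω := lt_of_le_of_ne hω (Ne.symm hne)
  obtain ⟨n, hlt⟩ := exists_nat_one_div_lt (lt_min hpos (Real.exp_pos (-θ * r ω)))
  exact hn n ⟨(hlt.trans_le (min_le_left _ _)).le, (hlt.trans_le (min_le_right _ _)).le⟩

theorem tiltedTransform_lt_of_lt (hX : Measurable X) (hr : Measurable r)
    (h0 : ∀ᵐ ω ∂μ, 0 ≤ X ω) (hX0 : ¬ ∀ᵐ ω ∂μ, X ω = 0) {y z : ℝ} (hy : 0 ≤ y) (hyz : y < z)
    (hfin : tiltedTransform μ θ r X y ≠ ∞) :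
    tiltedTransform μ θ r X y < tiltedTransform μ θ r X z := by
  refine lintegral_strict_mono_of_ae_le_of_frequently_ae_lt (by fun_prop) hfin ?_ ?_
  · filter_upwards [h0] with ω hω
    gcongr
  · intro hall
    refine hX0 ?_
    filter_upwards [h0, hall] with ω hω h
    by_contra hne
    refine h (ne_of_lt ?_)
    have hpow := Real.rpow_lt_rpow hy hyz (lt_of_le_of_ne hω (Ne.symm hne))
    have hzpos : 0 < z := hy.trans_lt hyz
    rw [ENNReal.ofReal_lt_ofReal_iff (by positivity)]
    gcongr

theorem isVarRewardRoot_iff (hX : Measurable X) (hr : Measurable r) {ζ : ℝ} :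
    IsVarRewardRoot μ θ r X ζ ↔ 1 ≤ ζ ∧ tiltedTransform μ θ r X ζ = 1 := by
  unfold IsVarRewardRoot tiltedTransform
  refine and_congr_right fun hζ => ?_
  have hnn : ∀ ω, 0 ≤ Real.exp (-θ * r ω) * ζ ^ X ω := fun ω => by positivity
  have hm : Measurable fun ω => Real.exp (-θ * r ω) * ζ ^ X ω := by fun_prop
  constructor
  · rintro ⟨hi, h1⟩
    rw [← ofReal_integral_eq_lintegral_ofReal hi (ae_of_all _ hnn), h1, ENNReal.ofReal_one]
  · intro h1
    have hi : Integrable (fun ω => Real.exp (-θ * r ω) * ζ ^ X ω) μ := by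
      refine ⟨hm.aestronglyMeasurable, ?_⟩
      rw [hasFiniteIntegral_iff_ofReal (ae_of_all _ hnn), h1]
      exact ENNReal.one_lt_top
    refine ⟨hi, ?_⟩
    rw [integral_eq_lintegral_of_nonneg_ae (ae_of_all _ hnn) hm.aestronglyMeasurable, h1,
      ENNReal.toReal_one]

theorem IsVarRewardRoot.unique (hX : Measurable X) (hr : Measurable r)
    (h0 : ∀ᵐ ω ∂μ, 0 ≤ X ω) (hX0 : ¬ ∀ᵐ ω ∂μ, X ω = 0) {ζ ζ' : ℝ}
    (h : IsVarRewardRoot μ θ r X ζ) (h' : IsVarRewardRoot μ θ r X ζ') : ζ' = ζ := by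
  rw [isVarRewardRoot_iff hX hr] at h h'
  by_contra hne
  rcases lt_or_gt_of_ne hne with hlt | hlt
  · have := tiltedTransform_lt_of_lt (θ := θ) hX hr h0 hX0 (zero_le_one.trans h'.1) hlt
      (by simp [h'.2])
    simp [h.2, h'.2] at this
  · have := tiltedTransform_lt_of_lt (θ := θ) hX hr h0 hX0 (zero_le_one.trans h.1) hlt
      (by simp [h.2])
    simp [h.2, h'.2] at this

/-- The intermediate value theorem on `[1, z]`: at `1` the transform is at most `1` because the
reward is nonnegative. -/
theorem exists_isVarRewardRoot_of_one_le [IsProbabilityMeasure μ] (hθ : 0 < θ)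
    (hX : Measurable X) (hr : Measurable r)
    (h0 : ∀ᵐ ω ∂μ, 0 ≤ X ω) (hr0 : ∀ᵐ ω ∂μ, 0 ≤ r ω) {z : ℝ} (hz : 1 ≤ z)
    (hi : Integrable (fun ω => Real.exp (-θ * r ω) * z ^ X ω) μ)
    (h1 : 1 ≤ ∫ ω, Real.exp (-θ * r ω) * z ^ X ω ∂μ) :
    ∃ ζ, IsVarRewardRoot μ θ r X ζ := by
  have hbound : ∀ y ∈ Set.Icc 1 z, ∀ᵐ ω ∂μ,
      ‖Real.exp (-θ * r ω) * y ^ X ω‖ ≤ Real.exp (-θ * r ω) * z ^ X ω := by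
    rintro y ⟨hy1, hyz⟩
    filter_upwards [h0] with ω hω
    rw [Real.norm_of_nonneg (by positivity)]
    gcongr
  have hcont : ContinuousOn (fun y : ℝ => ∫ ω, Real.exp (-θ * r ω) * y ^ X ω ∂μ)
      (Set.Icc 1 z) := by
    refine continuousOn_of_dominated (fun y _ => ?_) hbound hi (ae_of_all _ fun ω y hy => ?_)
    · exact Measurable.aestronglyMeasurable (by fun_prop)
    · have hy' : y ≠ 0 := by linarith [hy.1]
      exact (continuousAt_const.mul
        (Real.continuousAt_rpow_const _ _ (Or.inl hy'))).continuousWithinAt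
  have hle : ∫ ω, Real.exp (-θ * r ω) * (1 : ℝ) ^ X ω ∂μ ≤ 1 := by
    have : ∫ ω, Real.exp (-θ * r ω) * (1 : ℝ) ^ X ω ∂μ ≤ ∫ _, (1 : ℝ) ∂μ := by
      refine integral_mono_of_nonneg (ae_of_all _ fun ω => by positivity)
        (integrable_const _) ?_
      filter_upwards [hr0] with ω hω
      simp only [Real.one_rpow, mul_one, Real.exp_le_one_iff]
      nlinarith
    simpa using this
  obtain ⟨ζ, hζ, hζ1⟩ := intermediate_value_Icc hz hcont ⟨hle, h1⟩
  have hm : Measurable fun ω => Real.exp (-θ * r ω) * ζ ^ X ω := by fun_prop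
  exact ⟨ζ, hζ.1, hi.mono' hm.aestronglyMeasurable (hbound ζ hζ), hζ1⟩

theorem exists_isVarRewardRoot_of_bounded [IsProbabilityMeasure μ] (hθ : 0 < θ)
    (hX : Measurable X) (hr : Measurable r)
    (h0 : ∀ᵐ ω ∂μ, 0 ≤ X ω) (hX0 : ¬ ∀ᵐ ω ∂μ, X ω = 0) (hr0 : ∀ᵐ ω ∂μ, 0 ≤ r ω)
    {K : ℝ} (hK : ∀ᵐ ω ∂μ, X ω ≤ K) : ∃ ζ, IsVarRewardRoot μ θ r X ζ := by
  obtain ⟨ε, hε, hp⟩ := exists_pos_measure_le_and_le_exp (μ := μ) θ r h0 hX0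
  set B : Set Ω := {ω | ε ≤ X ω ∧ ε ≤ Real.exp (-θ * r ω)} with hB
  have hBm : MeasurableSet B :=
    (measurableSet_le measurable_const hX).inter
      (measurableSet_le measurable_const (hr.const_mul (-θ)).exp)
  have hp' : 0 < μ.real B := ENNReal.toReal_pos hp (measure_ne_top _ _)
  -- `z` is chosen so that already the contribution `ε * z ^ ε * μ B` of `B` is at least `1`.
  set z : ℝ := max 1 ((1 / (ε * μ.real B)) ^ (1 / ε)) with hz
  have hz1 : 1 ≤ z := le_max_left _ _
  have hzε : 1 / (ε * μ.real B) ≤ z ^ ε := by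
    calc 1 / (ε * μ.real B) = ((1 / (ε * μ.real B)) ^ (1 / ε)) ^ ε := by
          rw [← Real.rpow_mul (by positivity), one_div_mul_cancel hε.ne', Real.rpow_one]
      _ ≤ z ^ ε := Real.rpow_le_rpow (by positivity) (le_max_right _ _) hε.le
  have hi : Integrable (fun ω => Real.exp (-θ * r ω) * z ^ X ω) μ := by
    have hm : Measurable fun ω => Real.exp (-θ * r ω) * z ^ X ω := by fun_prop
    refine (integrable_const (z ^ K)).mono' hm.aestronglyMeasurable ?_
    filter_upwards [hr0, hK] with ω hω hωK
    rw [Real.norm_of_nonneg (by positivity)]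
    have he : Real.exp (-θ * r ω) ≤ 1 := by
      rw [Real.exp_le_one_iff]
      nlinarith
    calc Real.exp (-θ * r ω) * z ^ X ω ≤ 1 * z ^ K := by gcongr
      _ = z ^ K := one_mul _
  refine exists_isVarRewardRoot_of_one_le hθ hX hr h0 hr0 hz1 hi ?_
  calc (1 : ℝ) = μ.real B * (ε * (1 / (ε * μ.real B))) := by field_simp
    _ ≤ μ.real B * (ε * z ^ ε) := by gcongr
    _ = ∫ ω, B.indicator (fun _ => ε * z ^ ε) ω ∂μ := by
      rw [integral_indicator_const _ hBm, smul_eq_mul]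
    _ ≤ ∫ ω, Real.exp (-θ * r ω) * z ^ X ω ∂μ := by
      refine integral_mono ((integrable_const _).indicator hBm) hi fun ω => ?_
      by_cases hω : ω ∈ B
      · rw [Set.indicator_of_mem hω]
        have := hω.1
        have := hω.2
        gcongr
      · rw [Set.indicator_of_notMem hω]
        positivity

/-- For `z < ζ` the value of the transform at `z` is strictly below its value `1` at the root. -/
theorem IsVarRewardRoot.tiltedTransform_lt_one (hX : Measurable X) (hr : Measurable r)
    (h0 : ∀ᵐ ω ∂μ, 0 ≤ X ω) (hX0 : ¬ ∀ᵐ ω ∂μ, X ω = 0) {ζ z : ℝ}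
    (h : IsVarRewardRoot μ θ r X ζ) (hz : 0 ≤ z) (hzζ : z < ζ) :
    tiltedTransform μ θ r X z < 1 := by
  rw [isVarRewardRoot_iff hX hr] at h
  have hfin : tiltedTransform μ θ r X z ≠ ∞ := by
    refine ne_top_of_le_ne_top (b := tiltedTransform μ θ r X ζ) (by simp [h.2]) ?_
    refine lintegral_mono_ae ?_
    filter_upwards [h0] with ω hω
    gcongr
  exact (tiltedTransform_lt_of_lt hX hr h0 hX0 hz hzζ hfin).trans_eq h.2

theorem IsVarRewardRoot.one_lt_tiltedTransform (hX : Measurable X) (hr : Measurable r)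
    (h0 : ∀ᵐ ω ∂μ, 0 ≤ X ω) (hX0 : ¬ ∀ᵐ ω ∂μ, X ω = 0) {ζ z : ℝ}
    (h : IsVarRewardRoot μ θ r X ζ) (hζz : ζ < z) : 1 < tiltedTransform μ θ r X z := by
  rw [isVarRewardRoot_iff hX hr] at h
  exact h.2.symm.trans_lt
    (tiltedTransform_lt_of_lt hX hr h0 hX0 (zero_le_one.trans h.1) hζz (by simp [h.2]))

/-! ### Constant rewards -/

/-- A root `ζ ≥ 0` of `E[ζ ^ X] = exp (θ R)` with `θ R ≥ 0` is automatically at least `1`, so that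
the constant reward equation is the variable reward equation for the reward `R`. -/
theorem isConstRewardRoot_iff [IsProbabilityMeasure μ] {R : ℝ} (hθ : 0 < θ) (hR : 0 ≤ R)
    (hX : Measurable X)
    (h0 : ∀ᵐ ω ∂μ, 0 ≤ X ω) (hX0 : ¬ ∀ᵐ ω ∂μ, X ω = 0) {ζ : ℝ} :
    IsConstRewardRoot μ θ R X ζ ↔ IsVarRewardRoot μ θ (fun _ => R) X ζ := by
  have hint : Integrable (fun ω => Real.exp (-θ * R) * ζ ^ X ω) μ ↔
      Integrable (fun ω => ζ ^ X ω) μ :=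
    integrable_const_mul_iff (Real.exp_pos _).ne'.isUnit _
  have hval : ∫ ω, Real.exp (-θ * R) * ζ ^ X ω ∂μ = 1 ↔
      ∫ ω, ζ ^ X ω ∂μ = Real.exp (θ * R) := by
    rw [integral_const_mul, neg_mul, Real.exp_neg, inv_mul_eq_one₀ (Real.exp_pos _).ne', eq_comm]
  unfold IsConstRewardRoot IsVarRewardRoot
  rw [hint, hval]
  refine ⟨fun ⟨hζ, hi, h1⟩ => ⟨?_, hi, h1⟩, fun ⟨hζ, hi, h1⟩ => ⟨zero_le_one.trans hζ, hi, h1⟩⟩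
  by_contra! hlt
  have htop : tiltedTransform μ θ (fun _ => (0 : ℝ)) X ζ = ENNReal.ofReal (Real.exp (θ * R)) := by
    rw [← h1, ofReal_integral_eq_lintegral_ofReal hi (ae_of_all _ fun ω => by positivity)]
    simp [tiltedTransform]
  have hone : tiltedTransform μ θ (fun _ => (0 : ℝ)) X 1 = 1 := by simp [tiltedTransform]
  have := tiltedTransform_lt_of_lt (θ := θ) (r := fun _ => 0) hX measurable_const h0 hX0 hζ hlt
    (by simp [htop])
  rw [htop, hone, ← ENNReal.ofReal_one, ENNReal.ofReal_lt_ofReal_iff zero_lt_one,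
    Real.exp_lt_one_iff] at this
  nlinarith

/-- The bound `y ^ x ≥ 1 + x log y` makes `X` integrable once `y ^ X` is, for some `y > 1`. -/
theorem integrable_of_integrable_rpow [IsFiniteMeasure μ] (hX : Measurable X)
    (h0 : ∀ᵐ ω ∂μ, 0 ≤ X ω) {y : ℝ} (hy : 1 < y) (hi : Integrable (fun ω => y ^ X ω) μ) :
    Integrable X μ := by
  have hlog := Real.log_pos hy
  refine (hi.const_mul (1 / Real.log y)).mono' hX.aestronglyMeasurable ?_
  filter_upwards [h0] with ω hω
  rw [Real.norm_of_nonneg hω, one_div, ← div_eq_inv_mul, le_div_iff₀ hlog,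
    Real.rpow_def_of_pos (zero_lt_one.trans hy)]
  nlinarith [Real.add_one_le_exp (Real.log y * X ω)]

/-- Jensen's inequality for `x ↦ ζ ^ x`, through the tangent line at `E[X]`. -/
theorem rpow_integral_le_integral_rpow [IsProbabilityMeasure μ] {ζ : ℝ} (hζ : 0 < ζ)
    (hX : Integrable X μ) (hi : Integrable (fun ω => ζ ^ X ω) μ) :
    ζ ^ (∫ ω, X ω ∂μ) ≤ ∫ ω, ζ ^ X ω ∂μ := by
  set m := ∫ ω, X ω ∂μ with hm
  have hXm : Integrable (fun ω => X ω - m) μ := hX.sub (integrable_const _)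
  have hlin : Integrable (fun ω => ζ ^ m * (1 + Real.log ζ * (X ω - m))) μ :=
    ((integrable_const _).add (hXm.const_mul _)).const_mul _
  calc ζ ^ m = ∫ ω, ζ ^ m * (1 + Real.log ζ * (X ω - m)) ∂μ := by
        rw [integral_const_mul, integral_add (integrable_const _) (hXm.const_mul _),
          integral_const_mul, integral_sub hX (integrable_const _)]
        simp [← hm]
    _ ≤ ∫ ω, ζ ^ X ω ∂μ := by
        refine integral_mono hlin hi fun ω => ?_
        have hsplit : ζ ^ X ω = ζ ^ m * ζ ^ (X ω - m) := by
          rw [← Real.rpow_add hζ, add_sub_cancel]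
        simp only [hsplit]
        gcongr
        rw [Real.rpow_def_of_pos hζ]
        linarith [Real.add_one_le_exp (Real.log ζ * (X ω - m))]

theorem IsConstRewardRoot.one_lt {R : ℝ} (hθ : 0 < θ) (hR : 0 < R) [IsProbabilityMeasure μ]
    {ζ : ℝ} (hζ : 1 ≤ ζ) (h : IsConstRewardRoot μ θ R X ζ) : 1 < ζ := by
  refine lt_of_le_of_ne hζ fun heq => ?_
  have h1 := h.2.2
  rw [← heq] at h1
  simp only [Real.one_rpow, integral_const, probReal_univ, smul_eq_mul, mul_one] at h1
  have := Real.exp_eq_one_iff (θ * R) |>.1 h1.symm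
  have := mul_pos hθ hR
  linarith

theorem IsConstRewardRoot.mem_Icc [IsProbabilityMeasure μ] {R : ℝ} (hθ : 0 < θ) (hR : 0 ≤ R)
    (hX : Measurable X) (h0 : ∀ᵐ ω ∂μ, 0 ≤ X ω) (hX0 : ¬ ∀ᵐ ω ∂μ, X ω = 0) {ζ : ℝ}
    (h : IsConstRewardRoot μ θ R X ζ) :
    ζ ∈ Set.Icc 1 (Real.exp (θ * R / ∫ ω, X ω ∂μ)) := by
  have hvar := (isConstRewardRoot_iff hθ hR hX h0 hX0).1 h
  refine ⟨hvar.1, ?_⟩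
  rcases hR.eq_or_lt with hR0 | hRpos
  · subst hR0
    have h1 : IsVarRewardRoot μ θ (fun _ => (0 : ℝ)) X 1 := by
      refine ⟨le_rfl, ?_, ?_⟩ <;> simp
    have := IsVarRewardRoot.unique hX measurable_const h0 hX0 h1 hvar
    simp [this]
  · have hζ1 := h.one_lt hθ hRpos hvar.1
    have hi := integrable_of_integrable_rpow hX h0 hζ1 h.2.1
    have hζ0 : 0 < ζ := zero_lt_one.trans hζ1
    have hm : 0 < ∫ ω, X ω ∂μ := by
      refine lt_of_le_of_ne (integral_nonneg_of_ae h0) fun heq => hX0 ?_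
      exact (integral_eq_zero_iff_of_nonneg_ae h0 hi).1 heq.symm
    have hJ := rpow_integral_le_integral_rpow hζ0 hi h.2.1
    rw [h.2.2, Real.rpow_def_of_pos hζ0, Real.exp_le_exp] at hJ
    rw [← Real.log_le_iff_le_exp hζ0, le_div_iff₀ hm]
    exact hJ

end Roots

/-! ### Renewal times along a sample path -/

section SamplePath

variable {Ω : Type*} {X : ℕ → Ω → ℝ}

theorem renewalTime_succ (n : ℕ) (ω : Ω) : renewalTime X (n + 1) ω = renewalTime X n ω + X n ω :=
  Finset.sum_range_succ _ _

theorem monotone_renewalTime {ω : Ω} (h : ∀ i, 0 ≤ X i ω) :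
    Monotone fun n => renewalTime X n ω :=
  monotone_nat_of_le_succ fun n => by
    rw [renewalTime_succ]
    linarith [h n]

theorem renewalTime_renewalCount_le {ω : Ω} {t : ℝ} (ht : 0 ≤ t) (h : ∀ i, 0 ≤ X i ω)
    (hex : ∃ n, t < renewalTime X n ω) :
    renewalTime X (renewalCount X t ω) ω ≤ t ∧
      t < renewalTime X (renewalCount X t ω + 1) ω := by
  obtain ⟨n, hn⟩ := hex
  have hbdd : BddAbove {n : ℕ | renewalTime X n ω ≤ t} := by
    refine ⟨n, fun k hk => ?_⟩
    by_contra! hnk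
    exact absurd (hn.trans_le (monotone_renewalTime h hnk.le)) (not_lt.2 hk)
  have hne : {n : ℕ | renewalTime X n ω ≤ t}.Nonempty := ⟨0, by simpa [renewalTime] using ht⟩
  refine ⟨Nat.sSup_mem hne hbdd, ?_⟩
  by_contra! hle
  have : renewalCount X t ω + 1 ≤ renewalCount X t ω := le_csSup hbdd hle
  omega

end SamplePath

/-! ### Sums of i.i.d. pairs -/

section Sums

variable {Ω : Type*} [MeasurableSpace Ω] {μ : Measure Ω}

theorem IsIIDSequence.comp {E F : Type*} [MeasurableSpace E] [MeasurableSpace F]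
    {Y : ℕ → Ω → E} (h : IsIIDSequence Y μ) {g : E → F} (hg : Measurable g) :
    IsIIDSequence (fun i ω => g (Y i ω)) μ :=
  ⟨fun i => hg.comp (h.measurable i), h.indep.comp (fun _ => g) (fun _ => hg),
    fun i => (h.identDistrib i).comp hg⟩

/-- The sum of the first `n` terms is independent of the next term, which may be replaced by an
independent copy of the first term. -/
theorem IsIIDSequence.lintegral_sum_range_next {E : Type*} [MeasurableSpace E] [AddCommMonoid E]
    [MeasurableAdd₂ E] [IsProbabilityMeasure μ] {Y : ℕ → Ω → E} (h : IsIIDSequence Y μ) (n : ℕ)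
    {G : E × E → ℝ≥0∞} (hG : Measurable G) :
    ∫⁻ ω, G (∑ i ∈ Finset.range n, Y i ω, Y n ω) ∂μ =
      ∫⁻ ω', ∫⁻ ω, G (∑ i ∈ Finset.range n, Y i ω, Y 0 ω') ∂μ ∂μ := by
  have hsum : Measurable fun ω => ∑ i ∈ Finset.range n, Y i ω :=
    Finset.measurable_sum _ fun i _ => h.measurable i
  have hind : IndepFun (fun ω => ∑ i ∈ Finset.range n, Y i ω) (Y n) μ := by
    have := h.indep.indepFun_finsetSum_of_notMem h.measurable
      (s := Finset.range n) (i := n) Finset.notMem_range_self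
    convert this using 1
    ext ω
    simp
  rw [← lintegral_map (f := G) (g := fun ω => (∑ i ∈ Finset.range n, Y i ω, Y n ω)) hG
      (hsum.prodMk (h.measurable n)),
    (indepFun_iff_map_prod_eq_prod_map_map hsum.aemeasurable (h.measurable n).aemeasurable).1 hind,
    (h.identDistrib n).map_eq, lintegral_prod_symm _ hG.aemeasurable,
    lintegral_map (hG.lintegral_prod_left') (h.measurable 0)]
  refine lintegral_congr fun ω' => ?_
  rw [lintegral_map (f := fun x => G (x, Y 0 ω')) (hG.comp (by fun_prop)) hsum]

variable {X r : ℕ → Ω → ℝ}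

theorem IsIIDSequence.lintegral_renewalTime_next [IsProbabilityMeasure μ]
    (h : IsIIDSequence (fun i ω => (X i ω, r i ω)) μ) (n : ℕ)
    {G : (ℝ × ℝ) × (ℝ × ℝ) → ℝ≥0∞} (hG : Measurable G) :
    ∫⁻ ω, G ((renewalTime X n ω, ∑ i ∈ Finset.range n, r i ω), (X n ω, r n ω)) ∂μ =
      ∫⁻ ω', ∫⁻ ω, G ((renewalTime X n ω, ∑ i ∈ Finset.range n, r i ω), (X 0 ω', r 0 ω'))
        ∂μ ∂μ := by
  have := h.lintegral_sum_range_next n hG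
  have hsum : ∀ ω, ∑ i ∈ Finset.range n, (X i ω, r i ω) =
      (renewalTime X n ω, ∑ i ∈ Finset.range n, r i ω) := by
    intro ω
    rw [renewalTime, prod_mk_sum]
  simpa only [hsum] using this

theorem measurable_renewalTime (hX : ∀ i, Measurable (X i)) (n : ℕ) :
    Measurable (renewalTime X n) :=
  Finset.measurable_fun_sum _ fun i _ => hX i

theorem IsIIDSequence.measurable_interarrival (h : IsIIDSequence (fun i ω => (X i ω, r i ω)) μ) (i : ℕ) :
    Measurable (X i) := (h.measurable i).fst

theorem IsIIDSequence.measurable_reward (h : IsIIDSequence (fun i ω => (X i ω, r i ω)) μ) (i : ℕ) :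
    Measurable (r i) := (h.measurable i).snd

theorem IsIIDSequence.ae_nonneg (h : IsIIDSequence (fun i ω => (X i ω, r i ω)) μ)
    (h0 : ∀ᵐ ω ∂μ, 0 ≤ X 0 ω) : ∀ᵐ ω ∂μ, ∀ i, 0 ≤ X i ω := by
  rw [ae_all_iff]
  intro i
  exact ((h.identDistrib i).comp measurable_fst).symm.ae_snd
    (p := fun x => 0 ≤ x) measurableSet_Ici h0

theorem lintegral_tilted_renewalTime [IsProbabilityMeasure μ] {θ z : ℝ} (hz : 0 < z)
    (h : IsIIDSequence (fun i ω => (X i ω, r i ω)) μ) (n : ℕ) :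
    ∫⁻ ω, ENNReal.ofReal (Real.exp (-θ * ∑ i ∈ Finset.range n, r i ω) *
      z ^ renewalTime X n ω) ∂μ = tiltedTransform μ θ (r 0) (X 0) z ^ n := by
  induction n with
  | zero => simp [renewalTime]
  | succ n ih =>
    have hX := h.measurable_interarrival
    have hr := h.measurable_reward
    let G : (ℝ × ℝ) × (ℝ × ℝ) → ℝ≥0∞ := fun p =>
      ENNReal.ofReal (Real.exp (-θ * p.1.2) * z ^ p.1.1) *
        ENNReal.ofReal (Real.exp (-θ * p.2.2) * z ^ p.2.1)
    have hG : Measurable G := by fun_prop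
    have hm : Measurable fun ω => Real.exp (-θ * ∑ i ∈ Finset.range n, r i ω) *
        z ^ renewalTime X n ω := by
      have := measurable_renewalTime hX n
      fun_prop
    calc _ = ∫⁻ ω, G ((renewalTime X n ω, ∑ i ∈ Finset.range n, r i ω), (X n ω, r n ω)) ∂μ := by
          refine lintegral_congr fun ω => ?_
          simp only [G]
          rw [← ENNReal.ofReal_mul (by positivity), renewalTime_succ, Finset.sum_range_succ,
            Real.rpow_add hz, mul_add, Real.exp_add]
          ring_nf
      _ = _ := by
          rw [h.lintegral_renewalTime_next n hG]
          simp only [G]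
          simp_rw [lintegral_mul_const _ hm.ennreal_ofReal, ih]
          rw [lintegral_const_mul _ (by have := hX 0; have := hr 0; fun_prop), pow_succ]
          rfl

end Sums

/-! ### The renewal equation -/

section RenewalEquation

variable {Ω : Type*} [MeasurableSpace Ω]

/-- The tail function `t ↦ P(t < X)`, extended by `0` to negative times. -/
noncomputable def renewalTail (μ : Measure Ω) (X : Ω → ℝ) (t : ℝ) : ℝ≥0∞ :=
  if 0 ≤ t then μ {ω | t < X ω} else 0

/-- The contribution of the event `N_t = n` to `E[exp (-θ A_t)]`: the `n`-th renewal has happened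
by time `t`, and an independent further interarrival time reaches beyond `t`. -/
noncomputable def renewalTerm (μ : Measure Ω) (θ : ℝ) (X r : ℕ → Ω → ℝ) (n : ℕ) (t : ℝ) : ℝ≥0∞ :=
  ∫⁻ ω, ENNReal.ofReal (Real.exp (-θ * ∑ i ∈ Finset.range n, r i ω)) *
    renewalTail μ (X 0) (t - renewalTime X n ω) ∂μ

/-- The moment `E[exp (-θ A_t)]`, expanded over the value of `N_t`. -/
noncomputable def renewalMoment (μ : Measure Ω) (θ : ℝ) (X r : ℕ → Ω → ℝ) (t : ℝ) : ℝ≥0∞ :=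
  ∑' n, renewalTerm μ θ X r n t

variable {μ : Measure Ω}

theorem measurable_renewalTail (Y : Ω → ℝ) : Measurable (renewalTail μ Y) := by
  refine Measurable.ite measurableSet_Ici (Antitone.measurable ?_) measurable_const
  intro s t hst
  exact measure_mono fun ω hω => lt_of_le_of_lt hst hω

variable [IsProbabilityMeasure μ] {θ : ℝ} {X r : ℕ → Ω → ℝ}

theorem measurable_renewalTerm (h : IsIIDSequence (fun i ω => (X i ω, r i ω)) μ) (n : ℕ) :
    Measurable (renewalTerm μ θ X r n) := by
  have hX := measurable_renewalTime h.measurable_interarrival n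
  have hr := h.measurable_reward
  have ht := measurable_renewalTail (μ := μ) (X 0)
  refine Measurable.lintegral_prod_right' (f := fun p : ℝ × Ω =>
    ENNReal.ofReal (Real.exp (-θ * ∑ i ∈ Finset.range n, r i p.2)) *
      renewalTail μ (X 0) (p.1 - renewalTime X n p.2)) ?_
  fun_prop

theorem measurable_renewalMoment (h : IsIIDSequence (fun i ω => (X i ω, r i ω)) μ) :
    Measurable (renewalMoment μ θ X r) :=
  Measurable.tsum fun n => measurable_renewalTerm h n

theorem renewalTerm_zero (t : ℝ) : renewalTerm μ θ X r 0 t = renewalTail μ (X 0) t := by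
  simp [renewalTerm, renewalTime]

theorem renewalTerm_succ (h : IsIIDSequence (fun i ω => (X i ω, r i ω)) μ) (n : ℕ) (t : ℝ) :
    renewalTerm μ θ X r (n + 1) t =
      ∫⁻ ω, ENNReal.ofReal (Real.exp (-θ * r 0 ω)) * renewalTerm μ θ X r n (t - X 0 ω) ∂μ := by
  have ht := measurable_renewalTail (μ := μ) (X 0)
  have hX := measurable_renewalTime h.measurable_interarrival n
  have hr := h.measurable_reward
  let G : (ℝ × ℝ) × (ℝ × ℝ) → ℝ≥0∞ := fun p =>
    ENNReal.ofReal (Real.exp (-θ * p.2.2)) * (ENNReal.ofReal (Real.exp (-θ * p.1.2)) *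
      renewalTail μ (X 0) (t - p.2.1 - p.1.1))
  have hG : Measurable G := by fun_prop
  calc _ = ∫⁻ ω, G ((renewalTime X n ω, ∑ i ∈ Finset.range n, r i ω), (X n ω, r n ω)) ∂μ := by
        refine lintegral_congr fun ω => ?_
        simp only [G]
        rw [← mul_assoc, ← ENNReal.ofReal_mul (by positivity), renewalTime_succ,
          Finset.sum_range_succ, mul_add, Real.exp_add, sub_sub, add_comm (X n ω), mul_comm]
        rw [mul_comm (Real.exp (-θ * r n ω)), mul_comm]
    _ = _ := by
        rw [h.lintegral_renewalTime_next n hG]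
        refine lintegral_congr fun ω' => ?_
        simp only [G]
        rw [lintegral_const_mul _ (by fun_prop)]
        rfl

/-- The renewal equation, conditioning on one interarrival time and its reward. -/
theorem renewalMoment_eq (h : IsIIDSequence (fun i ω => (X i ω, r i ω)) μ) (t : ℝ) :
    renewalMoment μ θ X r t = renewalTail μ (X 0) t +
      ∫⁻ ω, ENNReal.ofReal (Real.exp (-θ * r 0 ω)) * renewalMoment μ θ X r (t - X 0 ω) ∂μ := by
  have hX := h.measurable_interarrival 0
  have hr := h.measurable_reward 0
  have hm := measurable_renewalTerm (θ := θ) h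
  unfold renewalMoment
  rw [tsum_eq_zero_add' ENNReal.summable, renewalTerm_zero]
  congr 1
  simp_rw [renewalTerm_succ h, ← ENNReal.tsum_mul_left]
  rw [lintegral_tsum fun n => by have := hm n; fun_prop]

/-! ### The moment of the accumulated reward -/

/-- Infinitely many renewals before a fixed time are impossible: by independence
`E[2 ^ (-T_n)] = E[2 ^ (-X)] ^ n → 0`. -/
theorem ae_exists_lt_renewalTime (h : IsIIDSequence (fun i ω => (X i ω, r i ω)) μ)
    (h0 : ∀ᵐ ω ∂μ, 0 ≤ X 0 ω) (hX0 : ¬ ∀ᵐ ω ∂μ, X 0 ω = 0) (t : ℝ) :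
    ∀ᵐ ω ∂μ, ∃ n, t < renewalTime X n ω := by
  have hX := h.measurable_interarrival
  have hr := h.measurable_reward
  set ρ := tiltedTransform μ 0 (r 0) (X 0) (1 / 2) with hρ
  have hρ1 : ρ < 1 := by
    have hroot : IsVarRewardRoot μ 0 (r 0) (X 0) 1 := by
      refine ⟨le_rfl, ?_, ?_⟩ <;> simp
    exact hroot.tiltedTransform_lt_one (hX 0) (hr 0) h0 hX0 (by norm_num) (by norm_num)
  have hle : ∀ n : ℕ, ENNReal.ofReal ((1 / 2 : ℝ) ^ t) * μ {ω | ∀ n, renewalTime X n ω ≤ t} ≤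
      ρ ^ n := by
    intro n
    have hpow := lintegral_tilted_renewalTime (θ := 0) (z := 1 / 2) (by norm_num) h n
    rw [← hρ] at hpow
    rw [← hpow]
    refine le_trans ?_ (mul_meas_ge_le_lintegral
      (by have := measurable_renewalTime hX n; fun_prop) (ENNReal.ofReal ((1 / 2 : ℝ) ^ t)))
    gcongr with ω
    intro hω
    simp only [neg_zero, zero_mul, Real.exp_zero, one_mul]
    exact ENNReal.ofReal_le_ofReal
      (Real.rpow_le_rpow_of_exponent_ge (by norm_num) (by norm_num) (hω n))
  have hz := ge_of_tendsto' (ENNReal.tendsto_pow_atTop_nhds_zero_of_lt_one hρ1) hle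
  have hpos : ENNReal.ofReal ((1 / 2 : ℝ) ^ t) ≠ 0 := by
    rw [Ne, ENNReal.ofReal_eq_zero, not_le]
    positivity
  have hμ : μ {ω | ∀ n, renewalTime X n ω ≤ t} = 0 :=
    (mul_eq_zero.1 (nonpos_iff_eq_zero.1 hz)).resolve_left hpos
  rw [ae_iff]
  simpa using hμ

/-- The expansion of `exp (-θ A_t)` over the value of `N_t`. -/
theorem ae_ofReal_exp_accumulatedReward_eq (θ : ℝ)
    (h : IsIIDSequence (fun i ω => (X i ω, r i ω)) μ)
    (h0 : ∀ᵐ ω ∂μ, 0 ≤ X 0 ω) (hX0 : ¬ ∀ᵐ ω ∂μ, X 0 ω = 0) {t : ℝ} (ht : 0 ≤ t) :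
    ∀ᵐ ω ∂μ, ENNReal.ofReal (Real.exp (-θ * accumulatedReward X r t ω)) =
      ∑' n, ENNReal.ofReal (Real.exp (-θ * ∑ i ∈ Finset.range n, r i ω)) *
        (if 0 ≤ t - renewalTime X n ω ∧ t - renewalTime X n ω < X n ω then 1 else 0) := by
  filter_upwards [h.ae_nonneg h0, ae_exists_lt_renewalTime h h0 hX0 t] with ω hω hex
  obtain ⟨h1, h2⟩ := renewalTime_renewalCount_le ht hω hex
  have hmono := monotone_renewalTime hω
  rw [tsum_eq_single (renewalCount X t ω)]
  · rw [renewalTime_succ] at h2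
    rw [if_pos ⟨by linarith, by linarith⟩, mul_one, accumulatedReward]
  · intro n hn
    rw [if_neg, mul_zero]
    rintro ⟨h3, h4⟩
    have h5 : t < renewalTime X (n + 1) ω := by rw [renewalTime_succ]; linarith
    rcases lt_or_gt_of_ne hn with hlt | hlt
    · exact absurd (h5.trans_le (hmono hlt)) (not_lt.2 h1)
    · linarith [hmono (show renewalCount X t ω + 1 ≤ n from hlt)]

theorem lintegral_exp_accumulatedReward (θ : ℝ)
    (h : IsIIDSequence (fun i ω => (X i ω, r i ω)) μ)
    (h0 : ∀ᵐ ω ∂μ, 0 ≤ X 0 ω) (hX0 : ¬ ∀ᵐ ω ∂μ, X 0 ω = 0) {t : ℝ} (ht : 0 ≤ t) :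
    AEMeasurable (fun ω => Real.exp (-θ * accumulatedReward X r t ω)) μ ∧
      ∫⁻ ω, ENNReal.ofReal (Real.exp (-θ * accumulatedReward X r t ω)) ∂μ =
        renewalMoment μ θ X r t := by
  have hX := h.measurable_interarrival
  have hT := measurable_renewalTime hX
  have hr := h.measurable_reward
  let G : (ℝ × ℝ) × (ℝ × ℝ) → ℝ≥0∞ := fun p => ENNReal.ofReal (Real.exp (-θ * p.1.2)) *
    (if 0 ≤ t - p.1.1 ∧ t - p.1.1 < p.2.1 then 1 else 0)
  have hG : Measurable G := by
    refine Measurable.mul (by fun_prop) (Measurable.ite ?_ measurable_const measurable_const)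
    have h1 : Measurable fun p : (ℝ × ℝ) × (ℝ × ℝ) => t - p.1.1 := by fun_prop
    have h2 : Measurable fun p : (ℝ × ℝ) × (ℝ × ℝ) => p.2.1 := by fun_prop
    exact (measurableSet_le measurable_const h1).inter (measurableSet_lt h1 h2)
  have hGm : ∀ n, Measurable fun ω =>
      G ((renewalTime X n ω, ∑ i ∈ Finset.range n, r i ω), (X n ω, r n ω)) := by
    intro n
    have := hT n
    exact hG.comp (by fun_prop)
  have hae := ae_ofReal_exp_accumulatedReward_eq θ h h0 hX0 ht
  constructor
  · refine ⟨fun ω => (∑' n,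
      G ((renewalTime X n ω, ∑ i ∈ Finset.range n, r i ω), (X n ω, r n ω))).toReal,
      (Measurable.tsum hGm).ennreal_toReal, ?_⟩
    filter_upwards [hae] with ω hω
    rw [← hω, ENNReal.toReal_ofReal (Real.exp_pos _).le]
  · rw [lintegral_congr_ae hae]
    refine (lintegral_tsum fun n => (hGm n).aemeasurable).trans ?_
    refine tsum_congr fun n => ?_
    rw [h.lintegral_renewalTime_next n hG, lintegral_lintegral_swap]
    · refine lintegral_congr fun ω => ?_
      have hset : MeasurableSet {ω' | t - renewalTime X n ω < X 0 ω'} :=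
        measurableSet_lt measurable_const (hX 0)
      simp only [G]
      rw [lintegral_const_mul _ (by
        refine Measurable.ite ?_ measurable_const measurable_const
        by_cases hc : 0 ≤ t - renewalTime X n ω <;> simp [hc, hset])]
      congr 1
      by_cases hc : 0 ≤ t - renewalTime X n ω
      · simp only [hc, true_and, renewalTail, if_true]
        rw [← lintegral_indicator_one hset]
        rfl
      · simp [hc, renewalTail]
    · have := hT n
      have := hX 0
      have := hr 0
      exact (hG.comp (by fun_prop)).aemeasurable

end RenewalEquation

/-! ### Exponential bounds for the moment -/

section Bounds

variable {Ω : Type*} [MeasurableSpace Ω] {μ : Measure Ω} {θ : ℝ}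

theorem exists_one_lt_truncated_tiltedTransform {r X : Ω → ℝ} {z : ℝ}
    (hz : 1 < tiltedTransform μ θ r X z) :
    ∃ A : ℝ, 0 ≤ A ∧
      1 < ∫⁻ ω in {ω | X ω ≤ A}, ENNReal.ofReal (Real.exp (-θ * r ω) * z ^ X ω) ∂μ := by
  have hmono : Monotone fun n : ℕ => {ω | X ω ≤ n} := by
    intro m n hmn ω hω
    have : (m : ℝ) ≤ n := by exact_mod_cast hmn
    exact le_trans (b := (m : ℝ)) hω this
  have huniv : ⋃ n : ℕ, {ω | X ω ≤ n} = Set.univ :=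
    Set.eq_univ_of_forall fun ω => Set.mem_iUnion.2 (exists_nat_ge (X ω))
  rw [tiltedTransform, ← setLIntegral_univ, ← huniv,
    setLIntegral_iUnion_of_directed _ (directed_of_isDirected_le hmono), lt_iSup_iff] at hz
  obtain ⟨n, hn⟩ := hz
  exact ⟨n, n.cast_nonneg, hn⟩

variable [IsProbabilityMeasure μ] {X r : ℕ → Ω → ℝ}

/-- Markov's inequality if `z ≥ 1`; for `z < 1` the factor `z ^ t` is at most `1`. -/
theorem renewalTail_mul_rpow_le {Y : Ω → ℝ} (hY : Measurable Y) {z : ℝ} (hz : 0 < z) (t : ℝ) :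
    renewalTail μ Y t * ENNReal.ofReal (z ^ t) ≤ 1 + ∫⁻ ω, ENNReal.ofReal (z ^ Y ω) ∂μ := by
  unfold renewalTail
  split_ifs with ht
  · have hset : MeasurableSet {ω | t < Y ω} := measurableSet_lt measurable_const hY
    calc μ {ω | t < Y ω} * ENNReal.ofReal (z ^ t)
        = ∫⁻ ω, {ω | t < Y ω}.indicator (fun _ => ENNReal.ofReal (z ^ t)) ω ∂μ := by
          rw [lintegral_indicator_const hset, mul_comm]
      _ ≤ ∫⁻ ω, (1 + ENNReal.ofReal (z ^ Y ω)) ∂μ := by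
          refine lintegral_mono fun ω => ?_
          by_cases hω : ω ∈ {ω | t < Y ω}
          · rw [Set.indicator_of_mem hω]
            rcases le_total 1 z with h1 | h1
            · exact le_add_left (ENNReal.ofReal_le_ofReal
                (Real.rpow_le_rpow_of_exponent_le h1 (le_of_lt hω)))
            · refine le_add_right ?_
              rw [← ENNReal.ofReal_one]
              exact ENNReal.ofReal_le_ofReal (Real.rpow_le_one hz.le h1 ht)
          · rw [Set.indicator_of_notMem hω]
            exact zero_le
      _ = 1 + ∫⁻ ω, ENNReal.ofReal (z ^ Y ω) ∂μ := by
          rw [lintegral_add_left measurable_const]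
          simp
  · simp

/-- If the transform is below `1` at `z`, the moment is `O(z ^ (-t))`: the `n`-th term of the
expansion is at most a constant times `z ^ (-t) * E[exp (-θ r) * z ^ X] ^ n`. -/
theorem renewalMoment_mul_rpow_le (h : IsIIDSequence (fun i ω => (X i ω, r i ω)) μ) {z : ℝ}
    (hz : 0 < z) (t : ℝ) :
    renewalMoment μ θ X r t * ENNReal.ofReal (z ^ t) ≤
      (1 + ∫⁻ ω, ENNReal.ofReal (z ^ X 0 ω) ∂μ) * (1 - tiltedTransform μ θ (r 0) (X 0) z)⁻¹ := by
  have hX := h.measurable_interarrival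
  have hT := measurable_renewalTime hX
  have hr := h.measurable_reward
  rw [renewalMoment, ← ENNReal.tsum_mul_right, ← ENNReal.tsum_geometric, ← ENNReal.tsum_mul_left]
  refine ENNReal.tsum_le_tsum fun n => ?_
  have hTn := hT n
  have ht := measurable_renewalTail (μ := μ) (X 0)
  rw [← lintegral_tilted_renewalTime hz h n, ← lintegral_const_mul _ (by fun_prop), renewalTerm,
    ← lintegral_mul_const _ (by fun_prop)]
  refine lintegral_mono fun ω => ?_
  have hsplit : ENNReal.ofReal (z ^ t) = ENNReal.ofReal (z ^ (t - renewalTime X n ω)) *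
      ENNReal.ofReal (z ^ renewalTime X n ω) := by
    rw [← ENNReal.ofReal_mul (by positivity), ← Real.rpow_add hz, sub_add_cancel]
  rw [hsplit, ENNReal.ofReal_mul (by positivity)]
  calc _ = (renewalTail μ (X 0) (t - renewalTime X n ω) *
        ENNReal.ofReal (z ^ (t - renewalTime X n ω))) *
        (ENNReal.ofReal (Real.exp (-θ * ∑ i ∈ Finset.range n, r i ω)) *
          ENNReal.ofReal (z ^ renewalTime X n ω)) := by ring
    _ ≤ _ := by
      gcongr
      exact renewalTail_mul_rpow_le (hX 0) hz _

/-- The moment is bounded away from zero on bounded time intervals. With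
`P(X ≥ ε, exp (-θ r) ≥ ε) > 0`, the renewal equation carries a lower bound on `[0, k ε)` over to
`[0, (k + 1) ε)`. -/
theorem exists_pos_le_renewalMoment (h : IsIIDSequence (fun i ω => (X i ω, r i ω)) μ)
    (h0 : ∀ᵐ ω ∂μ, 0 ≤ X 0 ω) (hX0 : ¬ ∀ᵐ ω ∂μ, X 0 ω = 0) (T : ℝ) :
    ∃ c : ℝ≥0∞, c ≠ 0 ∧ ∀ t ∈ Set.Icc 0 T, c ≤ renewalMoment μ θ X r t := by
  have hX := h.measurable_interarrival 0
  have hr := h.measurable_reward 0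
  obtain ⟨ε, hε, hp⟩ := exists_pos_measure_le_and_le_exp (μ := μ) θ (r 0) h0 hX0
  set B : Set Ω := {ω | ε ≤ X 0 ω ∧ ε ≤ Real.exp (-θ * r 0 ω)} with hB
  have hBm : MeasurableSet B :=
    (measurableSet_le measurable_const hX).inter
      (measurableSet_le measurable_const (hr.const_mul (-θ)).exp)
  have key : ∀ k : ℕ, ∃ c : ℝ≥0∞, c ≠ 0 ∧ ∀ t, 0 ≤ t → t < k * ε →
      c ≤ renewalMoment μ θ X r t := by
    intro k
    induction k with
    | zero =>
      refine ⟨1, one_ne_zero, fun t ht hlt => ?_⟩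
      simp only [Nat.cast_zero, zero_mul] at hlt
      linarith
    | succ k ih =>
      obtain ⟨c, hc, hck⟩ := ih
      have hεc : ENNReal.ofReal ε * c ≠ 0 := mul_ne_zero (by simpa using hε) hc
      refine ⟨min 1 (ENNReal.ofReal ε * c) * μ B, mul_ne_zero ?_ hp, fun t ht hlt => ?_⟩
      · exact (lt_min zero_lt_one (pos_iff_ne_zero.2 hεc)).ne'
      push_cast at hlt
      have hS : MeasurableSet {ω | t < X 0 ω} := measurableSet_lt measurable_const hX
      have hint : ENNReal.ofReal ε * c * μ (B \ {ω | t < X 0 ω}) ≤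
          ∫⁻ ω, ENNReal.ofReal (Real.exp (-θ * r 0 ω)) *
            renewalMoment μ θ X r (t - X 0 ω) ∂μ := by
        rw [← lintegral_indicator_const (hBm.diff hS)]
        refine lintegral_mono fun ω => ?_
        by_cases hω : ω ∈ B \ {ω | t < X 0 ω}
        · rw [Set.indicator_of_mem hω]
          obtain ⟨⟨h1, h2⟩, h3⟩ := hω
          have h3' : X 0 ω ≤ t := not_lt.1 h3
          have := hck (t - X 0 ω) (by linarith) (by linarith)
          gcongr
        · rw [Set.indicator_of_notMem hω]
          exact zero_le
      rw [renewalMoment_eq h]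
      calc min 1 (ENNReal.ofReal ε * c) * μ B
          = min 1 (ENNReal.ofReal ε * c) * μ (B ∩ {ω | t < X 0 ω}) +
            min 1 (ENNReal.ofReal ε * c) * μ (B \ {ω | t < X 0 ω}) := by
            rw [← mul_add, measure_inter_add_sdiff _ hS]
        _ ≤ 1 * μ {ω | t < X 0 ω} + ENNReal.ofReal ε * c * μ (B \ {ω | t < X 0 ω}) := by
            gcongr
            · exact min_le_left _ _
            · exact Set.inter_subset_right
            · exact min_le_right _ _
        _ ≤ _ := by
            rw [renewalTail, if_pos ht, one_mul]
            gcongr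
  obtain ⟨k, hk⟩ := exists_nat_gt (T / ε)
  obtain ⟨c, hc, hck⟩ := key k
  exact ⟨c, hc, fun t ht => hck t ht.1 (ht.2.trans_lt ((div_lt_iff₀ hε).1 hk))⟩

/-- If the transform exceeds `1` at `z`, the moment is at least a constant times `z ^ (-t)`.
A truncation `X ≤ A` leaves a value `ρ > 1` of the transform. By the renewal equation
`q t = E[exp (-θ A_t)] * z ^ t` is on `[A, T]` at least `ρ` times the infimum of `q` over `[0, T]`.
That infimum is therefore the one over `[0, A]`, which is positive and does not depend on `T`. -/
theorem exists_pos_le_renewalMoment_mul_rpow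
    (h : IsIIDSequence (fun i ω => (X i ω, r i ω)) μ)
    (h0 : ∀ᵐ ω ∂μ, 0 ≤ X 0 ω) (hX0 : ¬ ∀ᵐ ω ∂μ, X 0 ω = 0) {z : ℝ} (hz1 : 1 ≤ z)
    (hz : 1 < tiltedTransform μ θ (r 0) (X 0) z) :
    ∃ c : ℝ≥0∞, c ≠ 0 ∧ ∀ t, 0 ≤ t → c ≤ renewalMoment μ θ X r t * ENNReal.ofReal (z ^ t) := by
  have hX := h.measurable_interarrival 0
  have hr := h.measurable_reward 0
  have hmm := measurable_renewalMoment (θ := θ) h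
  have hz0 : 0 < z := zero_lt_one.trans_le hz1
  obtain ⟨A, hA, hρ⟩ := exists_one_lt_truncated_tiltedTransform hz
  set ρ := ∫⁻ ω in {ω | X 0 ω ≤ A}, ENNReal.ofReal (Real.exp (-θ * r 0 ω) * z ^ X 0 ω) ∂μ
  set q : ℝ → ℝ≥0∞ := fun t => renewalMoment μ θ X r t * ENNReal.ofReal (z ^ t) with hq
  have hbound : ∀ T, ∃ c : ℝ≥0∞, c ≠ 0 ∧ ∀ t ∈ Set.Icc 0 T, c ≤ q t := by
    intro T
    obtain ⟨c, hc, hcT⟩ := exists_pos_le_renewalMoment (θ := θ) h h0 hX0 T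
    refine ⟨c, hc, fun t ht => (hcT t ht).trans (le_mul_of_one_le_right' ?_)⟩
    rw [← ENNReal.ofReal_one]
    exact ENNReal.ofReal_le_ofReal (Real.one_le_rpow hz1 ht.1)
  have hinf : ∀ T, (⨅ t ∈ Set.Icc 0 T, q t) ≠ 0 := by
    intro T
    obtain ⟨c, hc, hcT⟩ := hbound T
    exact ((pos_iff_ne_zero.2 hc).trans_le (le_iInf₂ hcT)).ne'
  have hstep : ∀ T, ∀ t ∈ Set.Icc A T, ρ * (⨅ s ∈ Set.Icc 0 T, q s) ≤ q t := by
    rintro T t ⟨hAt, htT⟩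
    calc ρ * (⨅ s ∈ Set.Icc 0 T, q s)
        = ∫⁻ ω in {ω | X 0 ω ≤ A}, ENNReal.ofReal (Real.exp (-θ * r 0 ω) * z ^ X 0 ω) *
            (⨅ s ∈ Set.Icc 0 T, q s) ∂μ := by
          rw [lintegral_mul_const _ (by fun_prop)]
      _ ≤ ∫⁻ ω in {ω | X 0 ω ≤ A}, ENNReal.ofReal (Real.exp (-θ * r 0 ω) * z ^ X 0 ω) *
            q (t - X 0 ω) ∂μ := by
          refine lintegral_mono_ae ?_
          rw [ae_restrict_iff' (measurableSet_le hX measurable_const)]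
          filter_upwards [h0] with ω hω hωA
          have hωA' : X 0 ω ≤ A := hωA
          gcongr
          exact iInf₂_le _ ⟨by linarith, by linarith⟩
      _ ≤ ∫⁻ ω, ENNReal.ofReal (Real.exp (-θ * r 0 ω) * z ^ X 0 ω) * q (t - X 0 ω) ∂μ :=
          setLIntegral_le_lintegral _ _
      _ = (∫⁻ ω, ENNReal.ofReal (Real.exp (-θ * r 0 ω)) *
            renewalMoment μ θ X r (t - X 0 ω) ∂μ) * ENNReal.ofReal (z ^ t) := by
          rw [← lintegral_mul_const _ (by fun_prop)]
          refine lintegral_congr fun ω => ?_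
          have hsplit : ENNReal.ofReal (z ^ t) =
              ENNReal.ofReal (z ^ X 0 ω) * ENNReal.ofReal (z ^ (t - X 0 ω)) := by
            rw [← ENNReal.ofReal_mul (by positivity), ← Real.rpow_add hz0, add_sub_cancel]
          rw [hsplit, ENNReal.ofReal_mul (by positivity), hq]
          ring
      _ ≤ q t := by
          simp only [hq]
          gcongr
          rw [renewalMoment_eq h t]
          exact le_add_self
  refine ⟨⨅ t ∈ Set.Icc 0 A, q t, hinf A, fun T hT => ?_⟩
  suffices hAT : (⨅ t ∈ Set.Icc 0 A, q t) ≤ ⨅ t ∈ Set.Icc 0 T, q t from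
    hAT.trans (iInf₂_le T ⟨hT, le_rfl⟩)
  by_contra! hlt
  set I := ⨅ t ∈ Set.Icc 0 T, q t with hI
  have hI_top : I ≠ ∞ := hlt.ne_top
  have hIρ : I < ρ * I := by
    calc I = 1 * I := (one_mul I).symm
      _ < ρ * I := (ENNReal.mul_lt_mul_iff_left (hinf T) hI_top).2 hρ
  have hex : ∀ b, I < b → ∃ t ∈ Set.Icc 0 T, q t < b := fun b hb => by
    simpa only [hI, iInf_lt_iff, exists_prop] using hb
  obtain ⟨t, ht, hqt⟩ := hex _ (lt_min hlt hIρ)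
  rcases le_total t A with htA | htA
  · exact absurd (hqt.trans_le (min_le_left _ _)) (not_lt.2 (iInf₂_le t ⟨ht.1, htA⟩))
  · exact absurd (hqt.trans_le (min_le_right _ _)) (not_lt.2 (hstep T t ⟨htA, ht.2⟩))

end Bounds

/-! ### The effective capacity -/

/-- If `I t * z ^ t` stays bounded for `z < ζ` and stays away from `0` for `z > ζ`, then `I` has
the exponential rate `-log ζ`. -/
theorem tendsto_neg_log_div_of_rpow_bounds {θ ζ : ℝ} (hθ : 0 < θ) (hζ : 0 < ζ) {I : ℝ → ℝ}
    (hup : ∀ z, 0 < z → z < ζ → ∃ C, ∀ t, 0 ≤ t → I t * z ^ t ≤ C)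
    (hlow : ∀ z, ζ < z → ∃ c, 0 < c ∧ ∀ t, 0 ≤ t → c ≤ I t * z ^ t) :
    Tendsto (fun t : ℝ => -(1 / (θ * t)) * Real.log (I t)) atTop (𝓝 (Real.log ζ / θ)) := by
  have hpos : ∀ t, 0 ≤ t → 0 < I t := by
    intro t ht
    obtain ⟨c, hc, hcI⟩ := hlow (ζ + 1) (by linarith)
    exact pos_of_mul_pos_left (hc.trans_le (hcI t ht)) (by positivity)
  have hlog : ∀ b t : ℝ, 0 ≤ t →
      Real.log (I t * Real.exp (θ * b) ^ t) = Real.log (I t) + θ * b * t := by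
    intro b t ht
    rw [Real.log_mul (hpos t ht).ne' (by positivity), Real.log_rpow (Real.exp_pos _),
      Real.log_exp, mul_comm t]
  have hform : ∀ k b t : ℝ, 0 < t → -(1 / (θ * t)) * (k - θ * b * t) = b - k / θ / t := by
    intro k b t ht
    field_simp
    ring
  have hlim : ∀ k b : ℝ, Tendsto (fun t : ℝ => b - k / θ / t) atTop (𝓝 b) := by
    intro k b
    simpa using (tendsto_const_nhds (x := b)).sub
      ((tendsto_const_nhds (x := k / θ)).div_atTop tendsto_id)
  rw [tendsto_order]
  constructor
  · intro a ha
    obtain ⟨b, hab, hb⟩ := exists_between ha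
    have hbζ : Real.exp (θ * b) < ζ := by
      rw [← Real.lt_log_iff_exp_lt hζ]
      rwa [lt_div_iff₀ hθ, mul_comm] at hb
    obtain ⟨C, hC⟩ := hup _ (Real.exp_pos _) hbζ
    filter_upwards [(hlim (Real.log C) b).eventually_const_lt hab, eventually_gt_atTop 0]
      with t hat ht
    refine hat.trans_le ?_
    rw [← hform _ _ _ ht]
    have hle := Real.log_le_log (mul_pos (hpos t ht.le) (by positivity)) (hC t ht.le)
    rw [hlog b t ht.le] at hle
    refine mul_le_mul_of_nonpos_left (by linarith) ?_
    rw [neg_nonpos]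
    positivity
  · intro a ha
    obtain ⟨b, hb, hba⟩ := exists_between ha
    have hbζ : ζ < Real.exp (θ * b) := by
      rw [← Real.log_lt_iff_lt_exp hζ]
      rwa [div_lt_iff₀ hθ, mul_comm] at hb
    obtain ⟨c, hc, hcI⟩ := hlow _ hbζ
    filter_upwards [(hlim (Real.log c) b).eventually_lt_const hba, eventually_gt_atTop 0]
      with t hat ht
    refine lt_of_le_of_lt ?_ hat
    rw [← hform _ _ _ ht]
    have hle := Real.log_le_log hc (hcI t ht.le)
    rw [hlog b t ht.le] at hle
    refine mul_le_mul_of_nonpos_left (by linarith) ?_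
    rw [neg_nonpos]
    positivity

section Capacity

variable {Ω : Type*} [MeasurableSpace Ω] {μ : Measure Ω} [IsProbabilityMeasure μ]
  {θ : ℝ} {X r : ℕ → Ω → ℝ}

theorem IsVarRewardRoot.hasEffectiveCapacity (hθ : 0 < θ)
    (h : IsIIDSequence (fun i ω => (X i ω, r i ω)) μ)
    (h0 : ∀ᵐ ω ∂μ, 0 ≤ X 0 ω) (hX0 : ¬ ∀ᵐ ω ∂μ, X 0 ω = 0) {ζ : ℝ}
    (hζ : IsVarRewardRoot μ θ (r 0) (X 0) ζ)
    (hint : ∀ z ∈ Set.Ico 1 ζ, Integrable (fun ω => z ^ X 0 ω) μ) :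
    HasEffectiveCapacity μ θ (accumulatedReward X r) (Real.log ζ / θ) := by
  have hX := h.measurable_interarrival 0
  have hr := h.measurable_reward 0
  have hζ0 : 0 < ζ := zero_lt_one.trans_le hζ.1
  have hfin : ∀ z, 0 < z → z < ζ → ∫⁻ ω, ENNReal.ofReal (z ^ X 0 ω) ∂μ ≠ ∞ := by
    intro z hz hzζ
    rcases le_or_gt 1 z with h1 | h1
    · exact ((hasFiniteIntegral_iff_ofReal (ae_of_all _ fun ω => by positivity)).1
        (hint z ⟨h1, hzζ⟩).2).ne
    · refine ne_top_of_le_ne_top (b := ∫⁻ _, 1 ∂μ) (by simp) (lintegral_mono_ae ?_)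
      filter_upwards [h0] with ω hω
      rw [← ENNReal.ofReal_one]
      exact ENNReal.ofReal_le_ofReal (Real.rpow_le_one hz.le h1.le hω)
  have hup : ∀ z, 0 < z → z < ζ → ∃ C : ℝ≥0∞, C ≠ ∞ ∧ ∀ t,
      renewalMoment μ θ X r t * ENNReal.ofReal (z ^ t) ≤ C := by
    intro z hz hzζ
    refine ⟨_, ENNReal.mul_ne_top ?_ ?_, fun t => renewalMoment_mul_rpow_le h hz t⟩
    · exact ENNReal.add_ne_top.2 ⟨ENNReal.one_ne_top, hfin z hz hzζ⟩
    · have := hζ.tiltedTransform_lt_one hX hr h0 hX0 hz.le hzζ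
      exact ENNReal.inv_ne_top.2 (tsub_pos_of_lt this).ne'
  have htop : ∀ t, renewalMoment μ θ X r t ≠ ∞ := by
    intro t heq
    obtain ⟨C, hC, hCt⟩ := hup (ζ / 2) (by positivity) (by linarith)
    have hpos : ENNReal.ofReal ((ζ / 2) ^ t) ≠ 0 := by
      rw [Ne, ENNReal.ofReal_eq_zero, not_le]
      positivity
    have := hCt t
    rw [heq, ENNReal.top_mul hpos, top_le_iff] at this
    exact hC this
  have hnn : ∀ t ω, 0 ≤ Real.exp (-θ * accumulatedReward X r t ω) := fun t ω => by positivity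
  have hval : ∀ t, 0 ≤ t → ∫ ω, Real.exp (-θ * accumulatedReward X r t ω) ∂μ =
      (renewalMoment μ θ X r t).toReal := by
    intro t ht
    obtain ⟨hm, hl⟩ := lintegral_exp_accumulatedReward θ h h0 hX0 ht
    rw [integral_eq_lintegral_of_nonneg_ae (ae_of_all _ (hnn t)) hm.aestronglyMeasurable, hl]
  refine ⟨fun t ht => ?_, ?_⟩
  · obtain ⟨hm, hl⟩ := lintegral_exp_accumulatedReward θ h h0 hX0 ht
    refine ⟨hm.aestronglyMeasurable, ?_⟩
    rw [hasFiniteIntegral_iff_ofReal (ae_of_all _ (hnn t)), hl]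
    exact (htop t).lt_top
  · have htoReal : ∀ z t, 0 < z → 0 ≤ t →
        (renewalMoment μ θ X r t * ENNReal.ofReal (z ^ t)).toReal =
          (∫ ω, Real.exp (-θ * accumulatedReward X r t ω) ∂μ) * z ^ t := by
      intro z t hz ht
      rw [ENNReal.toReal_mul, ENNReal.toReal_ofReal (by positivity), hval t ht]
    refine tendsto_neg_log_div_of_rpow_bounds hθ hζ0 ?_ ?_
    · intro z hz hzζ
      obtain ⟨C, hC, hCt⟩ := hup z hz hzζ
      refine ⟨C.toReal, fun t ht => ?_⟩
      rw [← htoReal z t hz ht]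
      exact ENNReal.toReal_mono hC (hCt t)
    · intro z hzζ
      obtain ⟨c, hc, hct⟩ := exists_pos_le_renewalMoment_mul_rpow h h0 hX0
        (hζ.1.trans hzζ.le) (hζ.one_lt_tiltedTransform hX hr h0 hX0 hzζ)
      have hfinite : ∀ t, renewalMoment μ θ X r t * ENNReal.ofReal (z ^ t) ≠ ∞ :=
        fun t => ENNReal.mul_ne_top (htop t) ENNReal.ofReal_ne_top
      refine ⟨c.toReal, ENNReal.toReal_pos hc (ne_top_of_le_ne_top (hfinite 0) (hct 0 le_rfl)),
        fun t ht => ?_⟩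
      rw [← htoReal z t (hζ0.trans hzζ) ht]
      exact ENNReal.toReal_mono (hfinite t) (hct t ht)

end Capacity

/-! ### Existence, uniqueness and effective capacity -/

theorem mainTheorem5 {Ω : Type*} [MeasurableSpace Ω] (μ : Measure Ω) [IsProbabilityMeasure μ]
    (θ : ℝ) (hθ : 0 < θ) :
    -- constant reward
    (∀ (R : ℝ) (X : ℕ → Ω → ℝ), 0 ≤ R → IsIIDSequence X μ →
      (∀ᵐ ω ∂μ, 0 ≤ X 0 ω) → ¬ (∀ᵐ ω ∂μ, X 0 ω = 0) →
        -- existence of a root: bounded interarrival times, or a finite value above the level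
        ((∃ K : ℝ, ∀ᵐ ω ∂μ, X 0 ω ≤ K) → ∃ ζ, IsConstRewardRoot μ θ R (X 0) ζ) ∧
        ((∃ z : ℝ, 1 ≤ z ∧ Integrable (fun ω => z ^ X 0 ω) μ ∧
            Real.exp (θ * R) ≤ ∫ ω, z ^ X 0 ω ∂μ) → ∃ ζ, IsConstRewardRoot μ θ R (X 0) ζ) ∧
        -- the root is unique, lies in the stated interval, and gives the effective capacity
        ∀ ζ, IsConstRewardRoot μ θ R (X 0) ζ →
          (∀ ζ', IsConstRewardRoot μ θ R (X 0) ζ' → ζ' = ζ) ∧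
          (0 < R → Integrable (X 0) μ) ∧
          ζ ∈ Set.Icc 1 (Real.exp (θ * R / ∫ ω, X 0 ω ∂μ)) ∧
          HasEffectiveCapacity μ θ (fun t ω => R * (renewalCount X t ω : ℝ))
            (Real.log ζ / θ)) ∧
    -- variable reward
    (∀ {E : Type*} [MeasurableSpace E] (X : ℕ → Ω → ℝ) (S : ℕ → Ω → E) (R : ℝ → E → ℝ),
      Measurable (Function.uncurry R) → IsIIDSequence (fun i ω => (X i ω, S i ω)) μ →
      (∀ᵐ ω ∂μ, 0 ≤ X 0 ω) → ¬ (∀ᵐ ω ∂μ, X 0 ω = 0) →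
        -- existence of a root for nonnegative rewards, under the analogous two conditions
        ((∀ᵐ ω ∂μ, 0 ≤ R (X 0 ω) (S 0 ω)) → (∃ K : ℝ, ∀ᵐ ω ∂μ, X 0 ω ≤ K) →
          ∃ ζ, IsVarRewardRoot μ θ (fun ω => R (X 0 ω) (S 0 ω)) (X 0) ζ) ∧
        ((∀ᵐ ω ∂μ, 0 ≤ R (X 0 ω) (S 0 ω)) →
          (∃ z : ℝ, 1 ≤ z ∧
            Integrable (fun ω => Real.exp (-θ * R (X 0 ω) (S 0 ω)) * z ^ X 0 ω) μ ∧
            1 ≤ ∫ ω, Real.exp (-θ * R (X 0 ω) (S 0 ω)) * z ^ X 0 ω ∂μ) →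
          ∃ ζ, IsVarRewardRoot μ θ (fun ω => R (X 0 ω) (S 0 ω)) (X 0) ζ) ∧
        -- the root is unique, and gives the effective capacity
        ∀ ζ, IsVarRewardRoot μ θ (fun ω => R (X 0 ω) (S 0 ω)) (X 0) ζ →
          (∀ ζ', IsVarRewardRoot μ θ (fun ω => R (X 0 ω) (S 0 ω)) (X 0) ζ' → ζ' = ζ) ∧
          ((∀ z ∈ Set.Ico 1 ζ, Integrable (fun ω => z ^ X 0 ω) μ) →
            HasEffectiveCapacity μ θ
              (accumulatedReward X (fun i ω => R (X i ω) (S i ω))) (Real.log ζ / θ))) := by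
  refine ⟨fun R X hR hiid h0 hX0 => ?_, fun X S R hRm hiid h0 hX0 => ?_⟩
  · have hX : Measurable (X 0) := hiid.measurable 0
    have hR0 : ∀ᵐ _ ∂μ, 0 ≤ R := ae_of_all _ fun _ => hR
    have hiff : ∀ {ζ}, IsConstRewardRoot μ θ R (X 0) ζ ↔ IsVarRewardRoot μ θ (fun _ => R) (X 0) ζ :=
      isConstRewardRoot_iff hθ hR hX h0 hX0
    have hpair : IsIIDSequence (fun i ω => (X i ω, R)) μ :=
      hiid.comp (g := fun x => (x, R)) (by fun_prop)
    simp only [hiff]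
    refine ⟨fun ⟨K, hK⟩ => exists_isVarRewardRoot_of_bounded hθ hX measurable_const h0 hX0 hR0 hK,
      fun ⟨z, hz, hi, h1⟩ => ?_, fun ζ hζ => ⟨?_, fun hRpos => ?_, ?_, ?_⟩⟩
    · refine exists_isVarRewardRoot_of_one_le hθ hX measurable_const h0 hR0 hz (hi.const_mul _) ?_
      rw [integral_const_mul, neg_mul, Real.exp_neg]
      exact (le_inv_mul_iff₀ (Real.exp_pos _)).2 (by rwa [mul_one])
    · exact fun ζ' hζ' => hζ.unique hX measurable_const h0 hX0 hζ'
    · have hc := hiff.2 hζ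
      exact integrable_of_integrable_rpow hX h0 (hc.one_lt hθ hRpos hζ.1) hc.2.1
    · exact (hiff.2 hζ).mem_Icc hθ hR hX h0 hX0
    · have hcap := IsVarRewardRoot.hasEffectiveCapacity (r := fun _ _ => R) hθ hpair h0 hX0 hζ
        fun z hz => ?_
      · have hA : accumulatedReward X (fun _ _ => R) =
            fun t ω => R * (renewalCount X t ω : ℝ) := by
          ext t ω
          simp [accumulatedReward, mul_comm]
        rwa [hA] at hcap
      · have hz0 : 0 ≤ z := zero_le_one.trans hz.1
        have hm : Measurable fun ω => z ^ X 0 ω := by fun_prop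
        refine (hiff.2 hζ).2.1.mono' hm.aestronglyMeasurable ?_
        filter_upwards [h0] with ω hω
        rw [Real.norm_of_nonneg (by positivity)]
        exact Real.rpow_le_rpow hz0 hz.2.le hω
  · have hpair : IsIIDSequence (fun i ω => (X i ω, R (X i ω) (S i ω))) μ :=
      hiid.comp (g := fun p => (p.1, R p.1 p.2)) (measurable_fst.prodMk hRm)
    have hX := hpair.measurable_interarrival 0
    have hr := hpair.measurable_reward 0
    exact ⟨fun hR0 ⟨K, hK⟩ => exists_isVarRewardRoot_of_bounded hθ hX hr h0 hX0 hR0 hK,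
      fun hR0 ⟨z, hz, hi, h1⟩ => exists_isVarRewardRoot_of_one_le hθ hX hr h0 hR0 hz hi h1,
      fun ζ hζ => ⟨fun ζ' hζ' => hζ.unique hX hr h0 hX0 hζ',
        fun hint => IsVarRewardRoot.hasEffectiveCapacity
          (r := fun i ω => R (X i ω) (S i ω)) hθ hpair h0 hX0 hζ hint⟩⟩
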